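/- A partition $\lambda$ of $n$ (written $\lambda\vdash n$) is a sequence of positive integers $\lambda_1\ge\lambda_2\ge\cdots\ge\lambda_r$ with sum $n$. It has a fixed point if $\lambda_i=i$ for some $1\le i\le r$. Let $f(n)$ and $g(n)$ be the number of partitions of $n$ with, respectively without, a fixed point. Let $d(\lambda)$ be the number of indices $i$ with $\lambda_i\ge i$. The Frobenius symbol of $\lambda$ is the $2\times d(\lambda)$ array whose top row entry $a_i$ is the number of dots in row $i$ of the Ferrers diagram of $\lambda$ to the right of the diagonal, and whose bottom row entry $b_i$ is the number of dots in column $i$ below the diagonal ($1\le i\le d(\lambda)$). The mex of $\lambda$ is the smallest positive integer that is not a part of $\lambda$. Let $\omega(\lambda)$ be the number of parts equal to $1$ and $\mu(\lambda)$ the number of parts greater than $\omega(\lambda)$; the crank of $\lambda$ is $\lambda_1$ if $\omega(\lambda)=0$ and $\mu(\lambda)-\omega(\lambda)$ if $\omega(\lambda)>0$. Let $M(m,n)$ be the number of partitions of $n$ with crank $m$ ($m\in\mathbb{Z}$). Theorem. For each $n\ge 2$, the following four quantities are equal: (i) $f(n)$; (ii) $\#\{\lambda\vdash n \mid \text{the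 top row of the Frobenius symbol of }\lambda\text{ includes }0\}$; (iii) $\#\{\lambda\vdash n \mid \operatorname{mex}(\lambda)\equiv 0 \bmod 2\}$; (iv) $\sum_{m\ge 1} M(m,n)$. Also for each $n\ge 2$, the following four quantities are equal: (v) $g(n)$; (vi) $\#\{\lambda\vdash n \mid \text{the top row of the Frobenius symbol of }\lambda\text{ excludes }0\}$; (vii) $\#\{\lambda\vdash n \mid \operatorname{mex}(\lambda)\equiv 1 \bmod 2\}$; (viii) $\sum_{m\ge 0} M(m,n)$. -/

import Mathlib

namespace PartitionStat

/-- The parts of the partition, listed in nonincreasing order `λ₁ ≥ λ₂ ≥ ⋯`. -/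
def partList {n : ℕ} (p : n.Partition) : List ℕ := p.parts.sort (· ≥ ·)

/-- The number of parts. -/
def numParts {n : ℕ} (p : n.Partition) : ℕ := Multiset.card p.parts

/-- The `i`-th largest part `λ_i`, for `1 ≤ i ≤ numParts p` (indices start at 1).
The value at any larger index is `0`. -/
def part {n : ℕ} (p : n.Partition) (i : ℕ) : ℕ := (partList p).getD (i - 1) 0

/-- The partition has a fixed point: `λ_i = i` for some index `i` of a part. -/
def HasFixedPoint {n : ℕ} (p : n.Partition) : Prop :=
  ∃ i ∈ Finset.Icc 1 (numParts p), part p i = i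

instance {n : ℕ} : DecidablePred (HasFixedPoint (n := n)) := fun p =>
  inferInstanceAs (Decidable (∃ i ∈ Finset.Icc 1 (numParts p), part p i = i))

/-- The number of partitions of `n` with a fixed point. -/
def f (n : ℕ) : ℕ := Finset.card {p : n.Partition | HasFixedPoint p}

/-- The number of partitions of `n` without a fixed point. -/
def g (n : ℕ) : ℕ := Finset.card {p : n.Partition | ¬ HasFixedPoint p}

/-- The dots `(i, j)` (row, column) of the Ferrers diagram: row `i` has `λ_i` dots. -/
def ferrers {n : ℕ} (p : n.Partition) : Finset (ℕ × ℕ) :=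
  (Finset.Icc 1 (numParts p)).biUnion fun i =>
    (Finset.Icc 1 (part p i)).image fun j => (i, j)

/-- The side length of the Durfee square: the number of parts with `λ_i ≥ i`. -/
def durfee {n : ℕ} (p : n.Partition) : ℕ :=
  Finset.card {i ∈ Finset.Icc 1 (numParts p) | i ≤ part p i}

/-- The Frobenius symbol, a `2 × d` array where `d` is the side length of the Durfee square.
The top row counts, for each `i = 1, …, d`, the dots of row `i` to the right of the diagonal;
the bottom row counts the dots of column `i` below the diagonal.
The `Fin` index `k` stands for `i = k + 1`. -/
def frobeniusSymbol {n : ℕ} (p : n.Partition) : Matrix (Fin 2) (Fin (durfee p)) ℕ :=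
  Matrix.of ![
    fun k => Finset.card {c ∈ ferrers p | c.1 = (k : ℕ) + 1 ∧ (k : ℕ) + 1 < c.2},
    fun k => Finset.card {c ∈ ferrers p | c.2 = (k : ℕ) + 1 ∧ (k : ℕ) + 1 < c.1}]

theorem exists_pos_notMem_parts {n : ℕ} (p : n.Partition) : ∃ k, 0 < k ∧ k ∉ p.parts :=
  ⟨n + 1, Nat.succ_pos n, fun h => by have := Nat.Partition.le_of_mem_parts h; omega⟩

/-- The smallest positive integer that is not a part. -/
def mex {n : ℕ} (p : n.Partition) : ℕ := Nat.find (exists_pos_notMem_parts p)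

/-- The number of parts equal to 1. -/
def omega {n : ℕ} (p : n.Partition) : ℕ := p.parts.count 1

/-- The number of parts greater than the number of ones. -/
def mu {n : ℕ} (p : n.Partition) : ℕ := Multiset.card (p.parts.filter fun a => omega p < a)

/-- The crank. -/
def crank {n : ℕ} (p : n.Partition) : ℤ :=
  if omega p = 0 then (part p 1 : ℤ) else (mu p : ℤ) - (omega p : ℤ)

/-- `M m n` is the number of partitions of `n` with crank `m`. -/
def M (m : ℤ) (n : ℕ) : ℕ := Finset.card {p : n.Partition | crank p = m}

end PartitionStat

namespace PartitionStat

open Multiset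

/-! Let P_k (`HasPartAt k`) say that some part b can be given the index b + 1 - k; P_1 means a fixed
point. Removing b and adding 1 to each of the b - k largest other parts matches the partitions of n
with P_k to those of n - k without P_{k+1} (`card_hasPartAt_eq`). Deleting one part k gives the same
recursion for "the run of parts k, k + 1, … has odd length" (`card_oddRunFrom_eq`). So the two
counts agree for every k ≥ 1, and k = 1 compares fixed points with even mex.

For the crank, replacing b by b ones matches P_k with μ + k ≤ ω (`card_hasPartAt_eq_card_manyOnes`).
For k = 1 this is negative crank, whose complement is counted by g. For k = 0 it is crank ≤ 0; the
shift with k = 0 preserves n, so P_0 is as frequent as the failure of P_1, and the complement is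
counted by f.

The top Frobenius entries are λ_i - i for i ≤ d, so a 0 there is a fixed point. The statements for g
follow by complement. -/

/-- Two finite sets matched by a relation that is total and injective in both directions have
the same cardinality. -/
theorem card_eq_of_matching {α β : Type*} (s : Finset α) (t : Finset β) (r : α → β → Prop)
    (hs : ∀ a ∈ s, ∃ b ∈ t, r a b) (ht : ∀ b ∈ t, ∃ a ∈ s, r a b)
    (hr : ∀ a b b', r a b → r a b' → b = b') (hl : ∀ a a' b, r a b → r a' b → a = a') :
    s.card = t.card := by
  choose F hF hFr using hs
  refine Finset.card_bij F hF (fun a ha a' ha' h => ?_) (fun b hb => ?_)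
  · exact hl _ _ _ (hFr a ha) (h ▸ hFr a' ha')
  · obtain ⟨a, ha, hab⟩ := ht b hb
    exact ⟨a, ha, hr _ _ _ (hFr a ha) hab⟩

theorem countP_le_of_imp {S : Multiset ℕ} {p q : ℕ → Prop} [DecidablePred p] [DecidablePred q]
    (h : ∀ x, p x → q x) : S.countP p ≤ S.countP q := by
  rw [countP_eq_card_filter, countP_eq_card_filter]
  exact card_le_card (monotone_filter_right S h)

/-! ### Generalized fixed points and splitting at a threshold -/

/-- Some part `b` satisfies `λ_i = b` with `i = b + 1 - k`. For `k = 1` this says that there is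
a fixed point. -/
def HasPartAt (k : ℕ) (S : Multiset ℕ) : Prop :=
  ∃ b, S.countP (b < ·) + k ≤ b ∧ b < S.countP (b ≤ ·) + k

theorem countP_le_eq_count_add (S : Multiset ℕ) (b : ℕ) :
    S.countP (b ≤ ·) = S.count b + S.countP (b < ·) := by
  induction S using Multiset.induction_on with
  | empty => simp
  | cons a S ih =>
    simp only [countP_cons, count_cons, ih]
    split_ifs <;> omega

/-- The number of parts above b weakly decreases as b grows, so it can cross b - k only once. -/
theorem HasPartAt.unique {k : ℕ} {S : Multiset ℕ} {b b' : ℕ}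
    (h : S.countP (b < ·) + k ≤ b) (h₁ : b < S.countP (b ≤ ·) + k)
    (h' : S.countP (b' < ·) + k ≤ b') (h₁' : b' < S.countP (b' ≤ ·) + k) : b = b' := by
  rcases lt_trichotomy b b' with hb | hb | hb
  · have : S.countP (b' ≤ ·) ≤ S.countP (b < ·) := countP_le_of_imp fun x hx => by omega
    omega
  · exact hb
  · have : S.countP (b ≤ ·) ≤ S.countP (b' < ·) := countP_le_of_imp fun x hx => by omega
    omega

/-- The least `b` with at most `b - k` parts exceeding it. -/
theorem exists_crossing (k : ℕ) (S : Multiset ℕ) :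
    ∃ b, S.countP (b < ·) + k ≤ b ∧ (0 < b → b ≤ S.countP (b ≤ ·) + k) ∧
      ∀ c, S.countP (c < ·) + k ≤ c → b ≤ c := by
  have hex : ∃ b, S.countP (b < ·) + k ≤ b :=
    ⟨S.card + k, by have := S.countP_le_card (S.card + k < ·); omega⟩
  refine ⟨Nat.find hex, Nat.find_spec hex, fun hpos => ?_, fun c hc => Nat.find_min' hex hc⟩
  have hmin := Nat.find_min hex (m := Nat.find hex - 1) (by omega)
  have : S.countP (Nat.find hex - 1 < ·) ≤ S.countP (Nat.find hex ≤ ·) :=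
    countP_le_of_imp fun x hx => by omega
  omega

/-- The multiset `S` splits as `T₁ + T₂` with `T₁ ≥ b ≥ T₂` and a prescribed size of `T₁`. -/
theorem exists_split (S : Multiset ℕ) (b j : ℕ) (h : S.countP (b < ·) ≤ j)
    (h' : j ≤ S.countP (b ≤ ·)) :
    ∃ T₁ T₂, S = T₁ + T₂ ∧ (∀ x ∈ T₁, b ≤ x) ∧ (∀ x ∈ T₂, x ≤ b) ∧ card T₁ = j := by
  have hc := countP_le_eq_count_add S b
  refine ⟨S.filter (b < ·) + replicate (j - S.countP (b < ·)) b,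
    S.filter (· < b) + replicate (S.countP (b ≤ ·) - j) b, ?_, ?_, ?_, ?_⟩
  · ext x
    simp only [count_add, count_filter, count_replicate]
    rcases lt_trichotomy b x with hx | rfl | hx
    · simp [hx, hx.ne, hx.not_gt]
    · simp; omega
    · simp [hx, hx.ne', hx.not_gt]
  · intro x hx
    simp only [mem_add, mem_filter, mem_replicate] at hx
    omega
  · intro x hx
    simp only [mem_add, mem_filter, mem_replicate] at hx
    omega
  · rw [card_add, card_replicate, ← countP_eq_card_filter]
    omega

theorem split_unique {T₁ T₂ U₁ U₂ : Multiset ℕ} {b : ℕ} (h : T₁ + T₂ = U₁ + U₂)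
    (hT₁ : ∀ x ∈ T₁, b ≤ x) (hT₂ : ∀ x ∈ T₂, x ≤ b) (hU₁ : ∀ x ∈ U₁, b ≤ x)
    (hU₂ : ∀ x ∈ U₂, x ≤ b) (hc : card T₁ = card U₁) : T₁ = U₁ ∧ T₂ = U₂ := by
  -- The upper half consists of all elements above b, padded with copies of b to its prescribed
  -- size.
  have key : ∀ V₁ V₂ : Multiset ℕ, (∀ x ∈ V₁, b ≤ x) → (∀ x ∈ V₂, x ≤ b) →
      V₁ = (V₁ + V₂).filter (b < ·) + replicate (card V₁ - (V₁ + V₂).countP (b < ·)) b := by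
    intro V₁ V₂ h₁ h₂
    have e : (V₁ + V₂).filter (b < ·) = V₁.filter (b < ·) := by
      rw [filter_add, (filter_eq_nil (s := V₂)).2 (fun x hx => by have := h₂ x hx; omega), add_zero]
    have e' : V₁.countP (b ≤ ·) = card V₁ := countP_eq_card.2 h₁
    have hb := countP_le_eq_count_add V₁ b
    rw [countP_eq_card_filter, e, ← countP_eq_card_filter, ← e', hb]
    ext x
    simp only [count_add, count_filter, count_replicate]
    rcases lt_trichotomy b x with hx | rfl | hx
    · simp [hx, hx.ne]
    · simp
    · have : count x V₁ = 0 := count_eq_zero.2 fun hm => by have := h₁ x hm; omega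
      simp [hx.ne', this]
  have h₁ : T₁ = U₁ := by
    rw [key T₁ T₂ hT₁ hT₂, key U₁ U₂ hU₁ hU₂, h, hc]
  subst h₁
  exact ⟨rfl, add_left_cancel h⟩

/-! ### The shift bijection -/

/-- Remove the part `b` and enlarge each of the `b - k` largest remaining parts by one. -/
def ShiftRel (k : ℕ) (S V : Multiset ℕ) : Prop :=
  ∃ b T₁ T₂, S = b ::ₘ (T₁ + T₂) ∧ V = T₁.map (· + 1) + T₂ ∧ (∀ x ∈ T₁, b ≤ x) ∧
    (∀ x ∈ T₂, x ≤ b) ∧ card T₁ + k = b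

theorem countP_split {T₁ T₂ : Multiset ℕ} {b : ℕ} (h₁ : ∀ x ∈ T₁, b ≤ x)
    (h₂ : ∀ x ∈ T₂, x ≤ b) : (T₁.map (· + 1) + T₂).countP (b < ·) = card T₁ := by
  rw [countP_add, (countP_eq_zero (s := T₂)).2 (fun x hx => by have := h₂ x hx; omega),
    countP_eq_card.2, card_map, add_zero]
  intro x hx
  obtain ⟨y, hy, rfl⟩ := mem_map.1 hx
  have := h₁ y hy
  omega

theorem cons_split_bounds {T₁ T₂ : Multiset ℕ} {b k : ℕ} (h₁ : ∀ x ∈ T₁, b ≤ x)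
    (h₂ : ∀ x ∈ T₂, x ≤ b) (hc : card T₁ + k = b) :
    (b ::ₘ (T₁ + T₂)).countP (b < ·) + k ≤ b ∧ b < (b ::ₘ (T₁ + T₂)).countP (b ≤ ·) + k := by
  have e := (countP_eq_zero (s := T₂) (p := (b < ·))).2 (fun x hx => by have := h₂ x hx; omega)
  have e' := (countP_eq_card (s := T₁) (p := (b ≤ ·))).2 h₁
  have := T₁.countP_le_card (b < ·)
  simp only [countP_cons, countP_add]
  constructor
  · simp; omega
  · simp; omega

theorem ShiftRel.right_unique {k : ℕ} {S V V' : Multiset ℕ} (h : ShiftRel k S V)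
    (h' : ShiftRel k S V') : V = V' := by
  obtain ⟨b, T₁, T₂, rfl, rfl, h₁, h₂, hc⟩ := h
  obtain ⟨b', U₁, U₂, hS, rfl, h₁', h₂', hc'⟩ := h'
  obtain ⟨l, u⟩ := cons_split_bounds h₁ h₂ hc
  obtain ⟨l', u'⟩ := cons_split_bounds h₁' h₂' hc'
  rw [← hS] at l' u'
  obtain rfl := HasPartAt.unique l u l' u'
  obtain ⟨rfl, rfl⟩ := split_unique ((cons_inj_right _).1 hS) h₁ h₂ h₁' h₂' (by omega)
  rfl

/-- In V exactly b - k parts exceed b, and this determines b; those parts are the enlarged ones. -/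
theorem ShiftRel.left_unique {k : ℕ} {S S' V : Multiset ℕ} (h : ShiftRel k S V)
    (h' : ShiftRel k S' V) : S = S' := by
  obtain ⟨b, T₁, T₂, rfl, rfl, h₁, h₂, hc⟩ := h
  obtain ⟨b', U₁, U₂, rfl, hV, h₁', h₂', hc'⟩ := h'
  have e := countP_split h₁ h₂
  have e' := countP_split h₁' h₂'
  rw [← hV] at e'
  have hb : b = b' := by
    rcases le_total b b' with hb | hb
    · have : (T₁.map (· + 1) + T₂).countP (b' < ·) ≤ (T₁.map (· + 1) + T₂).countP (b < ·) :=
        countP_le_of_imp fun x hx => by omega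
      omega
    · have : (T₁.map (· + 1) + T₂).countP (b < ·) ≤ (T₁.map (· + 1) + T₂).countP (b' < ·) :=
        countP_le_of_imp fun x hx => by omega
      omega
  subst hb
  have key : ∀ V₁ V₂ : Multiset ℕ, (∀ x ∈ V₁, b ≤ x) → (∀ x ∈ V₂, x ≤ b) →
      (V₁.map (· + 1) + V₂).filter (b < ·) = V₁.map (· + 1) := by
    intro V₁ V₂ hV₁ hV₂
    rw [filter_add, (filter_eq_nil (s := V₂)).2 (fun x hx => by have := hV₂ x hx; omega), add_zero,
      filter_eq_self]
    intro x hx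
    obtain ⟨y, hy, rfl⟩ := mem_map.1 hx
    have := hV₁ y hy
    omega
  have hm : T₁.map (· + 1) = U₁.map (· + 1) := by
    rw [← key T₁ T₂ h₁ h₂, hV, key U₁ U₂ h₁' h₂']
  obtain rfl : T₁ = U₁ := map_injective (add_left_injective 1) hm
  obtain rfl : T₂ = U₂ := add_left_cancel hV
  rfl

theorem ShiftRel.hasPartAt {k : ℕ} {S V : Multiset ℕ} (h : ShiftRel k S V) : HasPartAt k S := by
  obtain ⟨b, T₁, T₂, rfl, rfl, h₁, h₂, hc⟩ := h
  exact ⟨b, cons_split_bounds h₁ h₂ hc⟩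

/-- Since exactly b - k parts of V exceed b, a candidate c ≤ b has too many parts above it and a
candidate c > b too few parts at or above it. -/
theorem ShiftRel.not_hasPartAt {k : ℕ} {S V : Multiset ℕ} (h : ShiftRel k S V) :
    ¬ HasPartAt (k + 1) V := by
  obtain ⟨b, T₁, T₂, rfl, rfl, h₁, h₂, hc⟩ := h
  rintro ⟨c, hl, hu⟩
  have e := countP_split h₁ h₂
  rcases le_or_gt c b with hcb | hcb
  · have : (T₁.map (· + 1) + T₂).countP (b < ·) ≤ (T₁.map (· + 1) + T₂).countP (c < ·) :=
      countP_le_of_imp fun x hx => by omega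
    omega
  · have : (T₁.map (· + 1) + T₂).countP (c ≤ ·) ≤ (T₁.map (· + 1) + T₂).countP (b < ·) :=
      countP_le_of_imp fun x hx => by omega
    omega

theorem sum_map_succ (T : Multiset ℕ) : (T.map (· + 1)).sum = T.sum + card T := by
  simp [sum_map_add]

theorem ShiftRel.sum_eq {k : ℕ} {S V : Multiset ℕ} (h : ShiftRel k S V) :
    S.sum = V.sum + k := by
  obtain ⟨b, T₁, T₂, rfl, rfl, h₁, h₂, hc⟩ := h
  rw [sum_cons, sum_add, sum_add, sum_map_succ]
  omega

theorem HasPartAt.exists_cons {k : ℕ} {S : Multiset ℕ} (h : HasPartAt k S) :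
    ∃ b T, S = b ::ₘ T ∧ T.countP (b < ·) + k ≤ b ∧ b ≤ T.countP (b ≤ ·) + k := by
  obtain ⟨b, hl, hu⟩ := h
  have hc := countP_le_eq_count_add S b
  have hb : b ∈ S := count_pos.1 (by omega)
  obtain ⟨T, rfl⟩ := exists_cons_of_mem hb
  refine ⟨b, T, rfl, ?_, ?_⟩
  · simpa [countP_cons] using hl
  · simp at hu
    omega

theorem HasPartAt.exists_shiftRel {k : ℕ} {S : Multiset ℕ} (h : HasPartAt k S) :
    ∃ V, ShiftRel k S V := by
  obtain ⟨b, T, rfl, hl, hu⟩ := h.exists_cons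
  obtain ⟨T₁, T₂, rfl, h₁, h₂, hc⟩ := exists_split T b (b - k) (by omega) (by omega)
  exact ⟨_, b, T₁, T₂, rfl, rfl, h₁, h₂, by omega⟩

theorem exists_shiftRel_of_not_hasPartAt {k : ℕ} {V : Multiset ℕ} (h : ¬ HasPartAt (k + 1) V) :
    ∃ S, ShiftRel k S V := by
  obtain ⟨b, hl, hu, -⟩ := exists_crossing k V
  -- If the inequality at the crossing were strict, b itself would witness `HasPartAt (k + 1) V`.
  have hb : V.countP (b < ·) + k = b := by
    by_contra hne
    exact h ⟨b, by omega, by have := hu (by omega); omega⟩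
  have e : ((V.filter (b < ·)).map (· - 1)).map (· + 1) = V.filter (b < ·) := by
    rw [map_map]
    conv_rhs => rw [← map_id (V.filter (b < ·))]
    refine map_congr rfl fun x hx => ?_
    have := (mem_filter.1 hx).2
    simp; omega
  refine ⟨_, b, (V.filter (b < ·)).map (· - 1), V.filter (¬ b < ·), rfl, ?_, ?_, ?_, ?_⟩
  · rw [e, filter_add_not]
  · intro x hx
    obtain ⟨y, hy, rfl⟩ := mem_map.1 hx
    have := (mem_filter.1 hy).2
    omega
  · intro x hx
    have := (mem_filter.1 hx).2
    omega
  · rw [card_map, ← countP_eq_card_filter, hb]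

theorem ShiftRel.pos_right {k : ℕ} {S V : Multiset ℕ} (h : ShiftRel k S V)
    (hS : ∀ x ∈ S, 0 < x) : ∀ x ∈ V, 0 < x := by
  obtain ⟨b, T₁, T₂, rfl, rfl, -, -, -⟩ := h
  intro x hx
  rcases mem_add.1 hx with hx | hx
  · obtain ⟨y, -, rfl⟩ := mem_map.1 hx
    omega
  · exact hS x (by simp [hx])

theorem ShiftRel.pos_left {k : ℕ} {S V : Multiset ℕ} (h : ShiftRel k S V) (hs : S.sum ≠ 0)
    (hV : ∀ x ∈ V, 0 < x) : ∀ x ∈ S, 0 < x := by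
  obtain ⟨b, T₁, T₂, rfl, rfl, h₁, h₂, hc⟩ := h
  -- If b = 0, every element of S is 0, against the nonzero sum.
  rcases Nat.eq_zero_or_pos b with rfl | hb
  · obtain rfl : T₁ = 0 := card_eq_zero.1 (by omega)
    exact absurd (by simpa using sum_eq_zero fun x hx => Nat.le_zero.1 (h₂ x hx)) hs
  · intro x hx
    rcases mem_cons.1 hx with rfl | hx
    · exact hb
    rcases mem_add.1 hx with hx | hx
    · exact hb.trans_le (h₁ x hx)
    · exact hV x (by simp [hx])

open Classical in
theorem card_hasPartAt_eq {n k : ℕ} (hk : k ≤ n) (hn : 0 < n) :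
    Finset.card {p : n.Partition | HasPartAt k p.parts} =
      Finset.card {q : (n - k).Partition | ¬ HasPartAt (k + 1) q.parts} := by
  refine card_eq_of_matching _ _ (fun p q => ShiftRel k p.parts q.parts) ?_ ?_ ?_ ?_
  · intro p hp
    obtain ⟨V, hV⟩ := (Finset.mem_filter.1 hp).2.exists_shiftRel
    have := hV.sum_eq
    rw [p.parts_sum] at this
    exact ⟨⟨V, fun {x} hx => hV.pos_right (fun _ h => p.parts_pos h) x hx, by omega⟩,
      by simpa using hV.not_hasPartAt, hV⟩
  · intro q hq
    obtain ⟨S, hS⟩ := exists_shiftRel_of_not_hasPartAt (Finset.mem_filter.1 hq).2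
    have := hS.sum_eq
    rw [q.parts_sum] at this
    exact ⟨⟨S, fun {x} hx => hS.pos_left (by omega) (fun _ h => q.parts_pos h) x hx, by omega⟩,
      by simpa using hS.hasPartAt, hS⟩
  · exact fun p q q' h h' => Nat.Partition.ext (h.right_unique h')
  · exact fun p p' q h h' => Nat.Partition.ext (h.left_unique h')

/-! ### Runs of consecutive parts and the common recursion -/

/-- The run of consecutive parts `k, k + 1, …` has odd length. -/
def OddRunFrom (k : ℕ) (S : Multiset ℕ) : Prop :=
  ∃ m, Odd m ∧ (∀ i < m, k + i ∈ S) ∧ k + m ∉ S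

theorem oddRunFrom_iff {k m : ℕ} {S : Multiset ℕ} (h : ∀ i < m, k + i ∈ S) (h' : k + m ∉ S) :
    OddRunFrom k S ↔ Odd m := by
  refine ⟨fun ⟨l, hl, hlt, hn⟩ => ?_, fun hm => ⟨m, hm, h, h'⟩⟩
  rcases lt_trichotomy l m with hlm | rfl | hlm
  · exact absurd (h l hlm) hn
  · exact hl
  · exact absurd (hlt m hlm) h'

theorem exists_run (k : ℕ) (S : Multiset ℕ) : ∃ m, (∀ i < m, k + i ∈ S) ∧ k + m ∉ S := by
  have hex : ∃ m, k + m ∉ S :=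
    ⟨S.sum + 1, fun h => by have := le_sum_of_mem h; omega⟩
  classical
  exact ⟨Nat.find hex, fun i hi => not_not.1 (Nat.find_min hex hi), Nat.find_spec hex⟩

theorem oddRunFrom_cons (k : ℕ) (T : Multiset ℕ) :
    OddRunFrom k (k ::ₘ T) ↔ ¬ OddRunFrom (k + 1) T := by
  obtain ⟨m, h, h'⟩ := exists_run (k + 1) T
  rw [oddRunFrom_iff h h', oddRunFrom_iff (m := m + 1), Nat.odd_add_one]
  · intro i hi
    rcases i with _ | i
    · simp
    · exact mem_cons_of_mem (by have := h i (by omega); rwa [add_assoc, add_comm 1] at this)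
  · rw [mem_cons, not_or]
    exact ⟨by omega, by rwa [add_assoc, add_comm 1] at h'⟩

theorem OddRunFrom.mem {k : ℕ} {S : Multiset ℕ} (h : OddRunFrom k S) : k ∈ S := by
  obtain ⟨m, hm, h, -⟩ := h
  simpa using h 0 hm.pos

theorem HasPartAt.exists_mem_ge {k : ℕ} {S : Multiset ℕ} (h : HasPartAt k S) :
    ∃ b ∈ S, k ≤ b := by
  obtain ⟨b, T, rfl, hl, -⟩ := h.exists_cons
  exact ⟨b, mem_cons_self _ _, by omega⟩

open Classical in
theorem card_oddRunFrom_eq {n k : ℕ} (hk : k ≤ n) (hk₀ : 0 < k) :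
    Finset.card {p : n.Partition | OddRunFrom k p.parts} =
      Finset.card {q : (n - k).Partition | ¬ OddRunFrom (k + 1) q.parts} := by
  refine card_eq_of_matching _ _ (fun p q => p.parts = k ::ₘ q.parts) ?_ ?_ ?_ ?_
  · intro p hp
    have h := (Finset.mem_filter.1 hp).2
    obtain ⟨T, hT⟩ := exists_cons_of_mem h.mem
    have hs := p.parts_sum
    rw [hT, oddRunFrom_cons] at h
    rw [hT, sum_cons] at hs
    exact ⟨⟨T, fun {x} hx => p.parts_pos (hT ▸ mem_cons_of_mem hx), by omega⟩, by simpa using h, hT⟩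
  · intro q hq
    have h := (Finset.mem_filter.1 hq).2
    refine ⟨⟨k ::ₘ q.parts, fun {x} hx => ?_, ?_⟩, ?_, rfl⟩
    · rcases mem_cons.1 hx with rfl | hx
      exacts [hk₀, q.parts_pos hx]
    · rw [sum_cons, q.parts_sum]; omega
    · simpa [oddRunFrom_cons] using h
  · exact fun p q q' h h' => Nat.Partition.ext ((cons_inj_right k).1 (h.symm.trans h'))
  · exact fun p p' q h h' => Nat.Partition.ext (h.trans h'.symm)

open Classical in
theorem card_not {n : ℕ} (P : n.Partition → Prop) :
    Finset.card {p : n.Partition | ¬ P p} =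
      Fintype.card n.Partition - Finset.card {p : n.Partition | P p} := by
  have := Finset.card_filter_add_card_filter_not (s := (Finset.univ : Finset n.Partition)) P
  rw [Finset.card_univ] at this
  refine Nat.eq_sub_of_add_eq' ?_
  convert this

open Classical in
theorem card_hasPartAt_eq_card_oddRunFrom (n k : ℕ) (hk : 0 < k) :
    Finset.card {p : n.Partition | HasPartAt k p.parts} =
      Finset.card {p : n.Partition | OddRunFrom k p.parts} := by
  induction n using Nat.strong_induction_on generalizing k with
  | _ n ih =>
    rcases lt_or_ge n k with h | h
    · have aux : ∀ p : n.Partition, ∀ b ∈ p.parts, b < k := fun p b hb =>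
        (Nat.Partition.le_of_mem_parts hb).trans_lt h
      rw [Finset.filter_false_of_mem, Finset.filter_false_of_mem]
      · exact fun p _ hp => (aux p k hp.mem).false
      · intro p _ hp
        obtain ⟨b, hb, hkb⟩ := hp.exists_mem_ge
        exact (aux p b hb).not_ge hkb
    · rw [card_hasPartAt_eq h (by omega), card_oddRunFrom_eq h hk, card_not, card_not,
        ih (n - k) (by omega) (k + 1) (by omega)]

/-! ### Trading a part for ones -/

/-- Replace the part `b` by `b` ones. -/
def OnesRel (k : ℕ) (S L : Multiset ℕ) : Prop :=
  ∃ b T, 0 < b ∧ S = b ::ₘ T ∧ L = T + replicate b 1 ∧ T.countP (b < ·) + k ≤ b ∧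
    b ≤ T.countP (b ≤ ·) + k

/-- At least `k` more ones than parts greater than the number of ones. -/
def ManyOnes (k : ℕ) (L : Multiset ℕ) : Prop :=
  L.countP (L.count 1 < ·) + k ≤ L.count 1

theorem OnesRel.hasPartAt {k : ℕ} {S L : Multiset ℕ} (h : OnesRel k S L) : HasPartAt k S := by
  obtain ⟨b, T, hb, rfl, rfl, hl, hu⟩ := h
  refine ⟨b, by simpa [countP_cons] using hl, ?_⟩
  simp; omega

theorem countP_lt_add_ones (T : Multiset ℕ) {b : ℕ} (hb : 0 < b) (c : ℕ) :
    (T + replicate c 1).countP (b < ·) = T.countP (b < ·) := by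
  rw [countP_add, (countP_eq_zero (s := replicate c 1)).2, add_zero]
  intro x hx
  rw [eq_of_mem_replicate hx]
  omega

theorem OnesRel.manyOnes {k : ℕ} {S L : Multiset ℕ} (h : OnesRel k S L) : ManyOnes k L := by
  obtain ⟨b, T, hb, rfl, rfl, hl, hu⟩ := h
  have hc : b ≤ (T + replicate b 1).count 1 := by simp
  unfold ManyOnes
  generalize (T + replicate b 1).count 1 = c at hc
  rw [countP_lt_add_ones T (by omega)]
  have : T.countP (c < ·) ≤ T.countP (b < ·) := countP_le_of_imp fun x hx => by omega
  omega

theorem OnesRel.right_unique {k : ℕ} {S L L' : Multiset ℕ} (h : OnesRel k S L)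
    (h' : OnesRel k S L') : L = L' := by
  obtain ⟨b, T, hb, rfl, rfl, hl, hu⟩ := h
  obtain ⟨b', T', hb', hS, rfl, hl', hu'⟩ := h'
  have e : b = b' := by
    apply HasPartAt.unique (k := k) (S := b ::ₘ T)
    · simpa [countP_cons] using hl
    · simp; omega
    · rw [hS]; simpa [countP_cons] using hl'
    · rw [hS]; simp; omega
  subst e
  rw [(cons_inj_right _).1 hS]

/-- Added ones never count among the parts above a positive c, so two candidate values of b would
both be crossings for the same multiset. -/
theorem OnesRel.left_unique {k : ℕ} {S S' L : Multiset ℕ} (h : OnesRel k S L)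
    (h' : OnesRel k S' L) : S = S' := by
  obtain ⟨b, T, hb, rfl, rfl, hl, hu⟩ := h
  obtain ⟨b', T', hb', rfl, hL, hl', hu'⟩ := h'
  have key : ∀ {U U' : Multiset ℕ} {c c' : ℕ}, 0 < c → U + replicate c 1 = U' + replicate c' 1 →
      U.countP (c < ·) + k ≤ c → c' ≤ U'.countP (c' ≤ ·) + k → ¬ c < c' := by
    intro U U' c c' hc hUU hlU huU hcc
    have h₁ : U'.countP (c' ≤ ·) ≤ U'.countP (c < ·) := countP_le_of_imp fun x hx => by omega
    have h₂ := countP_lt_add_ones U hc c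
    rw [hUU, countP_lt_add_ones U' hc] at h₂
    omega
  have e : b = b' := by
    have h₁ := key hb hL hl hu'
    have h₂ := key hb' hL.symm hl' hu
    omega
  subst e
  rw [add_right_cancel hL]

theorem HasPartAt.exists_onesRel {k : ℕ} {S : Multiset ℕ} (h : HasPartAt k S)
    (hS : ∀ x ∈ S, 0 < x) : ∃ L, OnesRel k S L := by
  obtain ⟨b, T, rfl, hl, hu⟩ := h.exists_cons
  exact ⟨_, b, T, hS b (mem_cons_self _ _), rfl, rfl, hl, hu⟩

theorem ManyOnes.exists_onesRel {k : ℕ} {L : Multiset ℕ} (h : ManyOnes k L)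
    (hL : ∀ x ∈ L, 0 < x) (hs : 2 ≤ L.sum) : ∃ S, OnesRel k S L := by
  obtain ⟨b, hl, hu, hmin⟩ := exists_crossing k L
  -- `ManyOnes` says that the number of ones satisfies the crossing inequality; by minimality of b,
  -- at least b ones are available to merge into one part.
  have hbc := hmin _ h
  have hb : 0 < b := by
    rcases Nat.eq_zero_or_pos b with rfl | hb
    · have h0 : L.countP (0 < ·) = card L := countP_eq_card.2 hL
      obtain rfl : L = 0 := card_eq_zero.1 (by omega)
      simp at hs
    · exact hb
  obtain ⟨T, rfl⟩ := le_iff_exists_add'.1 (le_count_iff_replicate_le.1 hbc)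
  rw [countP_lt_add_ones T hb] at hl
  refine ⟨_, b, T, hb, rfl, rfl, hl, ?_⟩
  have hu := hu hb
  -- For b > 1 the merged ones do not count among the parts ≥ b. For b = 1 they do, and the sum
  -- being at least 2 supplies another part.
  rcases Nat.lt_or_ge 1 b with h1 | h1
  · have := countP_lt_add_ones T (b := b - 1) (by omega) b
    have e : (fun x => b - 1 < x) = (b ≤ ·) := by
      funext x; exact propext (by omega)
    simp only [e] at this
    omega
  · obtain rfl : b = 1 := by omega
    have h0 : T.countP (1 ≤ ·) = card T :=
      countP_eq_card.2 fun x hx => hL x (mem_add.2 (Or.inl hx))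
    have : T ≠ 0 := by rintro rfl; simp at hs
    have := card_pos.2 this
    omega

open Classical in
theorem card_hasPartAt_eq_card_manyOnes {n : ℕ} (k : ℕ) (hn : 2 ≤ n) :
    Finset.card {p : n.Partition | HasPartAt k p.parts} =
      Finset.card {p : n.Partition | ManyOnes k p.parts} := by
  refine card_eq_of_matching _ _ (fun p q => OnesRel k p.parts q.parts) ?_ ?_ ?_ ?_
  · intro p hp
    obtain ⟨L, hL⟩ := (Finset.mem_filter.1 hp).2.exists_onesRel fun _ h => p.parts_pos h
    have hL' := hL
    obtain ⟨b, T, hb, hS, rfl, -, -⟩ := hL'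
    have hs := p.parts_sum
    rw [hS, sum_cons] at hs
    refine ⟨⟨_, fun {x} hx => ?_, ?_⟩, ?_, hL⟩
    · rcases mem_add.1 hx with hx | hx
      · exact p.parts_pos (hS ▸ mem_cons_of_mem hx)
      · rw [eq_of_mem_replicate hx]; exact one_pos
    · simp [sum_replicate]; omega
    · simpa using hL.manyOnes
  · intro q hq
    obtain ⟨S, hS⟩ := (Finset.mem_filter.1 hq).2.exists_onesRel (fun _ h => q.parts_pos h)
      (by rwa [q.parts_sum])
    have hS' := hS
    obtain ⟨b, T, hb, rfl, hL, -, -⟩ := hS'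
    have hs := q.parts_sum
    rw [hL, sum_add, sum_replicate, smul_eq_mul, mul_one] at hs
    refine ⟨⟨b ::ₘ T, fun {x} hx => ?_, ?_⟩, ?_, hS⟩
    · rcases mem_cons.1 hx with rfl | hx
      · exact hb
      · exact q.parts_pos (hL ▸ mem_add.2 (Or.inl hx))
    · rw [sum_cons]; omega
    · simpa using hS.hasPartAt
  · exact fun p q q' h h' => Nat.Partition.ext (h.right_unique h')
  · exact fun p p' q h h' => Nat.Partition.ext (h.left_unique h')

/-! ### Sorted parts and the Frobenius symbol -/

theorem le_getD_iff {l : List ℕ} (hl : l.Pairwise (· ≥ ·)) {b : ℕ} (hb : 0 < b) (i : ℕ) :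
    b ≤ l.getD i 0 ↔ i < l.countP (b ≤ ·) := by
  induction l generalizing i with
  | nil => simp; omega
  | cons a l ih =>
    rw [List.pairwise_cons] at hl
    rcases i with _ | i
    · simp only [List.getD_cons_zero, List.countP_cons]
      by_cases h : b ≤ a
      · simp [h]
      · have : l.countP (b ≤ ·) = 0 := List.countP_eq_zero.2 fun x hx => by
          have := hl.1 x hx
          simp; omega
        simp [h, this]
    · rw [List.getD_cons_succ, ih hl.2, List.countP_cons]
      by_cases h : b ≤ a
      · simp [h]
      · have : l.countP (b ≤ ·) = 0 := List.countP_eq_zero.2 fun x hx => by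
          have := hl.1 x hx
          simp; omega
        simp [h, this]

/-- Conjugation: this translates indexed parts into counts. Positivity of b makes the default value
0 harmless. -/
theorem le_part_iff {n : ℕ} (p : n.Partition) {b i : ℕ} (hb : 0 < b) (hi : 0 < i) :
    b ≤ part p i ↔ i ≤ p.parts.countP (b ≤ ·) := by
  rw [part, partList, le_getD_iff (pairwise_sort p.parts (· ≥ ·)) hb]
  have : p.parts.countP (b ≤ ·) = (p.parts.sort (· ≥ ·)).countP (b ≤ ·) := by
    conv_lhs => rw [← sort_eq p.parts (· ≥ ·)]
    rw [coe_countP]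
  rw [this]
  omega

theorem part_antitone {n : ℕ} (p : n.Partition) {i j : ℕ} (hi : 0 < i) (hij : i ≤ j) :
    part p j ≤ part p i := by
  rcases Nat.eq_zero_or_pos (part p j) with h | h
  · omega
  · have := (le_part_iff p h (hi.trans_le hij)).1 le_rfl
    exact (le_part_iff p h hi).2 (by omega)

theorem le_numParts {n : ℕ} (p : n.Partition) {i : ℕ} (hi : 0 < i) (h : 0 < part p i) :
    i ≤ numParts p :=
  ((le_part_iff p h hi).1 le_rfl).trans (countP_le_card _ _)

theorem hasFixedPoint_iff {n : ℕ} (p : n.Partition) :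
    HasFixedPoint p ↔ HasPartAt 1 p.parts := by
  have key : ∀ i, 0 < i → (part p i = i ↔
      p.parts.countP (i < ·) + 1 ≤ i ∧ i < p.parts.countP (i ≤ ·) + 1) := by
    intro i hi
    have h₁ := le_part_iff p hi hi
    have h₂ := le_part_iff p (b := i + 1) (by omega) hi
    have e : p.parts.countP (i + 1 ≤ ·) = p.parts.countP (i < ·) := rfl
    rw [e] at h₂
    omega
  constructor
  · rintro ⟨i, hi, h⟩
    exact ⟨i, (key i (Finset.mem_Icc.1 hi).1).1 h⟩
  · rintro ⟨i, h⟩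
    have hi : 0 < i := by omega
    have hp := (key i hi).2 h
    exact ⟨i, Finset.mem_Icc.2 ⟨hi, le_numParts p hi (by omega)⟩, hp⟩

theorem le_durfee_iff {n : ℕ} (p : n.Partition) {i : ℕ} (hi : 0 < i) :
    i ≤ durfee p ↔ i ≤ part p i := by
  constructor
  · intro h
    by_contra hlt
    have hsub : {j ∈ Finset.Icc 1 (numParts p) | j ≤ part p j} ⊆ Finset.Icc 1 (i - 1) := by
      intro j hj
      rw [Finset.mem_filter, Finset.mem_Icc] at hj
      rw [Finset.mem_Icc]
      by_contra hcon
      have := part_antitone p hi (show i ≤ j by omega)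
      omega
    have := Finset.card_le_card hsub
    rw [Nat.card_Icc] at this
    unfold durfee at h
    omega
  · intro h
    have hsub : Finset.Icc 1 i ⊆ {j ∈ Finset.Icc 1 (numParts p) | j ≤ part p j} := by
      intro j hj
      rw [Finset.mem_Icc] at hj
      have := part_antitone p hj.1 hj.2
      rw [Finset.mem_filter, Finset.mem_Icc]
      exact ⟨⟨hj.1, le_numParts p hj.1 (by omega)⟩, by omega⟩
    have := Finset.card_le_card hsub
    rw [Nat.card_Icc] at this
    unfold durfee
    omega

theorem frobeniusSymbol_top {n : ℕ} (p : n.Partition) (k : Fin (durfee p)) :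
    frobeniusSymbol p 0 k = part p (k + 1) - (k + 1) := by
  have hk := (le_durfee_iff p (i := k + 1) (by omega)).1 k.2
  have hN := le_numParts p (i := k + 1) (by omega) (by omega)
  have : {c ∈ ferrers p | c.1 = (k : ℕ) + 1 ∧ (k : ℕ) + 1 < c.2} =
      (Finset.Ioc ((k : ℕ) + 1) (part p (k + 1))).image fun j => ((k : ℕ) + 1, j) := by
    ext ⟨i, j⟩
    simp only [ferrers, Finset.mem_filter, Finset.mem_biUnion, Finset.mem_image, Finset.mem_Icc,
      Finset.mem_Ioc, Prod.mk.injEq]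
    constructor
    · rintro ⟨⟨a, -, b, hb, rfl, rfl⟩, rfl, h⟩
      exact ⟨b, ⟨h, hb.2⟩, rfl, rfl⟩
    · rintro ⟨b, hb, rfl, rfl⟩
      exact ⟨⟨_, ⟨by omega, hN⟩, b, ⟨by omega, hb.2⟩, rfl, rfl⟩, rfl, hb.1⟩
  change Finset.card {c ∈ ferrers p | c.1 = (k : ℕ) + 1 ∧ (k : ℕ) + 1 < c.2} = _
  rw [this, Finset.card_image_of_injective _ (Prod.mk_right_injective _), Nat.card_Ioc]

theorem exists_frobeniusSymbol_eq_zero_iff {n : ℕ} (p : n.Partition) :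
    (∃ k, frobeniusSymbol p 0 k = 0) ↔ HasFixedPoint p := by
  constructor
  · rintro ⟨k, hk⟩
    rw [frobeniusSymbol_top] at hk
    have h := (le_durfee_iff p (i := k + 1) (by omega)).1 k.2
    exact ⟨k + 1, Finset.mem_Icc.2 ⟨by omega, le_numParts p (by omega) (by omega)⟩, by omega⟩
  · rintro ⟨i, hi, h⟩
    have hi := (Finset.mem_Icc.1 hi).1
    have hd := (le_durfee_iff p hi).2 h.ge
    refine ⟨⟨i - 1, by omega⟩, ?_⟩
    rw [frobeniusSymbol_top]
    simp only [Nat.sub_add_cancel hi]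
    omega

/-! ### Mex and crank in terms of counts -/

theorem mex_modEq_zero_iff {n : ℕ} (p : n.Partition) :
    mex p ≡ 0 [MOD 2] ↔ OddRunFrom 1 p.parts := by
  have hs : 0 < mex p ∧ mex p ∉ p.parts := Nat.find_spec (exists_pos_notMem_parts p)
  rw [oddRunFrom_iff (m := mex p - 1)]
  · rw [Nat.odd_iff, Nat.ModEq]; omega
  · intro i hi
    have := Nat.find_min (exists_pos_notMem_parts p) (m := 1 + i) (by unfold mex at hi; omega)
    by_contra hcon
    exact this ⟨by omega, hcon⟩
  · rw [Nat.add_sub_cancel' hs.1]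
    exact hs.2

theorem mu_eq {n : ℕ} (p : n.Partition) : mu p = p.parts.countP (p.parts.count 1 < ·) :=
  (countP_eq_card_filter _ _).symm

/-- Without ones, the crank λ₁ and the difference μ - ω are both positive, so the special case does
not disturb the sign test. -/
theorem mu_pos_of_omega_eq_zero {n : ℕ} (hn : 0 < n) (p : n.Partition) (h : omega p = 0) :
    0 < mu p ∧ 0 < part p 1 := by
  have hc : p.parts.countP (0 < ·) = card p.parts := countP_eq_card.2 fun _ h => p.parts_pos h
  have hp : 0 < card p.parts := by
    rw [card_pos]
    intro h0
    have := p.parts_sum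
    rw [h0, sum_zero] at this
    omega
  refine ⟨?_, (le_part_iff p one_pos one_pos).2 ?_⟩
  · rw [mu_eq, show p.parts.count 1 = 0 from h]
    omega
  · exact (show 1 ≤ p.parts.countP (0 < ·) by omega)

theorem one_le_crank_iff {n : ℕ} (hn : 0 < n) (p : n.Partition) :
    1 ≤ crank p ↔ ¬ ManyOnes 0 p.parts := by
  rw [ManyOnes, ← mu_eq]
  change _ ↔ ¬ mu p + 0 ≤ omega p
  unfold crank
  split_ifs with h
  · have := mu_pos_of_omega_eq_zero hn p h
    omega
  · omega

theorem zero_le_crank_iff {n : ℕ} (p : n.Partition) :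
    0 ≤ crank p ↔ ¬ ManyOnes 1 p.parts := by
  rw [ManyOnes, ← mu_eq]
  change _ ↔ ¬ mu p + 1 ≤ omega p
  unfold crank
  split_ifs with h <;> omega

theorem hasSum_M (n : ℕ) (a : ℤ) :
    HasSum (fun m : Set.Ici a => M m n) (Finset.card {p : n.Partition | a ≤ crank p}) := by
  simp only [M, Finset.card_filter]
  -- The sums are exchanged: each partition contributes a single 1, at its own crank.
  refine hasSum_sum fun p _ => ?_
  by_cases h : a ≤ crank p
  · rw [if_pos h]
    convert hasSum_ite_eq (⟨crank p, h⟩ : Set.Ici a) 1 using 3 with m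
    rw [Subtype.ext_iff, eq_comm]
  · rw [if_neg h]
    convert hasSum_zero with m
    refine if_neg fun hm => h ?_
    rw [hm]
    exact m.2

/-! ### Complements and assembly -/

open Classical in
theorem f_eq_card_hasPartAt (n : ℕ) :
    f n = Finset.card {p : n.Partition | HasPartAt 1 p.parts} := by
  unfold f
  congr 1
  ext p
  simp [hasFixedPoint_iff]

open Classical in
theorem g_eq (n : ℕ) : g n = Fintype.card n.Partition - f n := by
  unfold f g
  convert card_not (n := n) HasFixedPoint

theorem g_eq_card_of_iff_not {n : ℕ} {P Q : n.Partition → Prop} [DecidablePred P]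
    [DecidablePred Q] (hf : f n = Finset.card {p : n.Partition | P p}) (h : ∀ p, Q p ↔ ¬ P p) :
    g n = Finset.card {p : n.Partition | Q p} := by
  classical
  simp_rw [h]
  rw [g_eq, hf]
  convert (card_not P).symm

end PartitionStat

theorem mainTheorem1 (n : ℕ) (hn : 2 ≤ n) :
    (PartitionStat.f n =
        Finset.card {p : n.Partition | ∃ k, PartitionStat.frobeniusSymbol p 0 k = 0} ∧
      PartitionStat.f n =
        Finset.card {p : n.Partition | PartitionStat.mex p ≡ 0 [MOD 2]} ∧
      HasSum (fun m : Set.Ici (1 : ℤ) => PartitionStat.M m n) (PartitionStat.f n)) ∧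
    (PartitionStat.g n =
        Finset.card {p : n.Partition | ∀ k, PartitionStat.frobeniusSymbol p 0 k ≠ 0} ∧
      PartitionStat.g n =
        Finset.card {p : n.Partition | PartitionStat.mex p ≡ 1 [MOD 2]} ∧
      HasSum (fun m : Set.Ici (0 : ℤ) => PartitionStat.M m n) (PartitionStat.g n)) := by
  open PartitionStat in
  classical
  have hf := f_eq_card_hasPartAt n
  -- The shift with k = 0 keeps the size n.
  have h₀ : f n = Finset.card {p : n.Partition | ¬ HasPartAt 0 p.parts} := by
    rw [card_not, card_hasPartAt_eq (Nat.zero_le n) (by omega), card_not, hf]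
    have := Finset.card_filter_le (Finset.univ : Finset n.Partition)
      fun p => HasPartAt 1 p.parts
    rw [Finset.card_univ] at this
    exact (Nat.sub_sub_self this).symm
  have hfr : f n = Finset.card {p : n.Partition | ∃ k, frobeniusSymbol p 0 k = 0} := by
    simp_rw [exists_frobeniusSymbol_eq_zero_iff]
    rfl
  have hmex : f n = Finset.card {p : n.Partition | mex p ≡ 0 [MOD 2]} := by
    simp_rw [mex_modEq_zero_iff]
    rw [hf, card_hasPartAt_eq_card_oddRunFrom n 1 one_pos]
  refine ⟨⟨hfr, hmex, ?_⟩, ?_, ?_, ?_⟩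
  · convert hasSum_M n 1
    simp_rw [one_le_crank_iff (show 0 < n by omega)]
    rw [h₀, card_not, card_not, card_hasPartAt_eq_card_manyOnes 0 hn]
  · exact g_eq_card_of_iff_not hfr fun p => not_exists.symm
  · refine g_eq_card_of_iff_not hmex fun p => ?_
    rw [Nat.ModEq, Nat.ModEq]
    omega
  · convert hasSum_M n 0
    simp_rw [zero_le_crank_iff]
    rw [g_eq, hf, card_not, card_hasPartAt_eq_card_manyOnes 1 hn]
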